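/- Let $f\in C^2(\mathbb{R}^n)$ and let $g:\mathbb{R}^n\to\mathbb{R}\cup\{\infty\}$ be a proper polyhedral function (its epigraph is a polyhedral set) with $\mathrm{dom}\,g\subseteq\mathbb{R}^n_+$. Put $\phi(x)=f(x)+g(x)$ and $\Phi(y)=f(y^2)+g(y^2)$, where $y^2$ is the componentwise square. For $h:\mathbb{R}^n\to\mathbb{R}\cup\{\infty\}$ let $\partial h$ be the limiting subdifferential: $v\in\hat\partial h(x)$ if $h(x)$ is finite and $h(z)\ge h(x)+\langle v,z-x\rangle+o(\|z-x\|)$ as $z\to x$; and $v\in\partial h(x)$ if $h(x)$ is finite and there are $x^k\to x$ with $h(x^k)\to h(x)$ and $v^k\in\hat\partial h(x^k)$ with $v^k\to v$. Let $\mathrm{dom}\,\partial h=\{x:\partial h(x)\ne\emptyset\}$. A proper closed function $h$ satisfies the KL property at $\bar x\in\mathrm{dom}\,\partial h$ with exponent $\alpha\in[0,1)$ if there are $\bar c>0$, $a\in(0,\infty]$ and a neighborhood $V$ of $\bar x$ such that $$\bar c(1-\alpha)\,(h(x)-h(\bar x))^{-\alpha}\,\mathrm{dist}(0,\partial h(x))\ge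 1\quad\text{for all }x\in V\text{ with }0<h(x)-h(\bar x)<a,$$ where $\mathrm{dist}(0,\emptyset)=\infty$. **Theorem.** Assume that $\phi$ is convex and that $\bar x=\bar y^2$ is a stationary point of $\phi$, i.e. $0\in\partial\phi(\bar x)$. Let $\Omega=\operatorname{argmin}_{x\in\mathbb{R}^n}\phi(x)$ and $I=\{i:\bar x_i\ne0\}$, and for $\rho\in\mathbb{R}^n_+$ let $S_\rho=\{x\in\mathbb{R}^n:|x_i-\bar x_i|\le\rho_i\ \text{for all } i\in I^c\}$, where $I^c=\{1,\dots,n\}\setminus I$. Assume that there are a neighborhood $U$ of $\bar x$ and constants $c>0$ and $\gamma\in(0,1]$ such that for all $\rho\in\mathbb{R}^n_+$ $$\mathrm{dist}(x,\Omega\cap S_\rho)\le c\,\max\{\mathrm{dist}(x,\Omega),\mathrm{dist}(x,S_\rho)\}^{\gamma}\qquad\text{for all }x\in U\cap\mathrm{dom}\,\partial\phi.$$ If $\phi$ satisfies the KL property at $\bar x$ with exponent $\alpha\in(0,1)$, then $\Phi$ satisfies the KL property at $\bar y$ with exponent $\frac{1+\beta}{2}$, where $\beta=1-\gamma(1-\alpha)$.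 -/

import Mathlib

open Set Filter Topology

namespace SquareKL

/-- A polyhedral set: the intersection of finitely many closed half-spaces. -/
def IsPolyhedralSet {F : Type*} [AddCommGroup F] [Module ℝ F] (S : Set F) : Prop :=
  ∃ (m : ℕ) (a : Fin m → F →ₗ[ℝ] ℝ) (b : Fin m → ℝ), S = {p | ∀ j, a j p ≤ b j}

/-- The epigraph of an extended real-valued function. -/
def epi {E : Type*} (h : E → EReal) : Set (E × ℝ) :=
  {p | h p.1 ≤ (p.2 : EReal)}

/-- The effective domain of an extended real-valued function. -/
def dom {E : Type*} (h : E → EReal) : Set E :=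
  {x | h x < ⊤}

/-- A function is proper if its domain is nonempty and it never takes the value `-∞`. -/
def IsProper {E : Type*} (h : E → EReal) : Prop :=
  (dom h).Nonempty ∧ ∀ x, ⊥ < h x

/-- A polyhedral function: the epigraph is a polyhedral set. -/
def IsPolyhedralFun {E : Type*} [AddCommGroup E] [Module ℝ E] (h : E → EReal) : Prop :=
  IsPolyhedralSet (epi h)

/-- A convex extended real-valued function: the epigraph is a convex set. -/
def IsConvexFun {E : Type*} [AddCommGroup E] [Module ℝ E] (h : E → EReal) : Prop :=
  Convex ℝ (epi h)

/-- The set of global minimizers. -/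
def argmin {E : Type*} (h : E → EReal) : Set E :=
  {x | ∀ z, h x ≤ h z}

section Subdifferential

variable {E : Type*} [NormedAddCommGroup E] [InnerProductSpace ℝ E]

/-- The regular (Fréchet) subdifferential at a point where `h` is finite: `v` belongs to it when
`h z ≥ h x + ⟨v, z - x⟩ + o(‖z - x‖)` as `z → x`. It is empty where `h` is not finite. -/
def regularSubdiff (h : E → EReal) (x : E) : Set E :=
  {v | h x ≠ ⊥ ∧ h x ≠ ⊤ ∧ ∀ ε : ℝ, 0 < ε → ∀ᶠ z in 𝓝 x,
    h x + ((inner ℝ v (z - x) - ε * ‖z - x‖ : ℝ) : EReal) ≤ h z}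

/-- The (limiting, Mordukhovich) subdifferential: limits of regular subgradients `vₖ` taken at
points `xₖ → x` with `h xₖ → h x`. It is empty where `h` is not finite. -/
def subdiff (h : E → EReal) (x : E) : Set E :=
  {v | h x ≠ ⊥ ∧ h x ≠ ⊤ ∧ ∃ (xs vs : ℕ → E),
    Tendsto xs atTop (𝓝 x) ∧ Tendsto (fun k => h (xs k)) atTop (𝓝 (h x)) ∧
    (∀ k, vs k ∈ regularSubdiff h (xs k)) ∧ Tendsto vs atTop (𝓝 v)}

/-- The domain of the subdifferential. -/
def domSubdiff (h : E → EReal) : Set E :=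
  {x | (subdiff h x).Nonempty}

/-- A stationary point: zero is a subgradient. -/
def IsStationary (h : E → EReal) (x : E) : Prop :=
  (0 : E) ∈ subdiff h x

/-- The proper closed function `h` satisfies the Kurdyka-Łojasiewicz property at `xbar` with
exponent `α ∈ [0, 1)`: near `xbar`, whenever `0 < h x - h xbar < a`, one has
`ψ'(h x - h xbar) * dist(0, ∂h x) ≥ 1` with `ψ s = c * s ^ (1 - α)`, so that
`ψ' s = c * (1 - α) * s ^ (-α)`. The distance is extended-valued: `dist(0, ∅) = ∞`. -/
def HasKLExponent (h : E → EReal) (xbar : E) (α : ℝ) : Prop :=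
  IsProper h ∧ LowerSemicontinuous h ∧ xbar ∈ domSubdiff h ∧ 0 ≤ α ∧ α < 1 ∧
    ∃ c : ℝ, 0 < c ∧ ∃ a : EReal, 0 < a ∧ ∃ V ∈ 𝓝 xbar, ∀ x ∈ V,
      0 < h x - h xbar → h x - h xbar < a →
        1 ≤ ENNReal.ofReal (c * (1 - α) * (h x - h xbar).toReal ^ (-α)) *
          Metric.infEDist 0 (subdiff h x)

end Subdifferential

/-- The componentwise square of a vector. -/
def sqVec {n : ℕ} (y : EuclideanSpace ℝ (Fin n)) : EuclideanSpace ℝ (Fin n) :=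
  WithLp.toLp 2 (fun i => y i ^ 2)

/-- The objective `φ = f + g`. -/
noncomputable def phi {n : ℕ} (f : EuclideanSpace ℝ (Fin n) → ℝ) (g : EuclideanSpace ℝ (Fin n) → EReal) :
    EuclideanSpace ℝ (Fin n) → EReal :=
  fun x => (f x : EReal) + g x

/-- The reparameterized objective `Φ(y) = f(y²) + g(y²)`. -/
noncomputable def bigPhi {n : ℕ} (f : EuclideanSpace ℝ (Fin n) → ℝ) (g : EuclideanSpace ℝ (Fin n) → EReal) :
    EuclideanSpace ℝ (Fin n) → EReal :=
  fun y => (f (sqVec y) : EReal) + g (sqVec y)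

/-- The box of all `x` with `|x i - xbar i| ≤ ρ i` for the indices `i ∈ J`; the other coordinates
are free. -/
def box {n : ℕ} (xbar : EuclideanSpace ℝ (Fin n)) (J : Set (Fin n)) (ρ : Fin n → ℝ) :
    Set (EuclideanSpace ℝ (Fin n)) :=
  {x | ∀ i ∈ J, |x i - xbar i| ≤ ρ i}

end SquareKL

namespace SquareKL

/-! Let `m` be the minimum of `φ`, let `v` be a regular subgradient of `Φ` at `y` near `ȳ`, and put
`x = y²`, `r = Φ(y)`. A chain rule gives a regular subgradient `u` of `φ` at `x` with `2 yᵢ uᵢ = vᵢ`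
wherever `yᵢ ≠ 0` (`exists_mem_regularSubdiff_phi`; curves whose squares are segments, plus Farkas'
lemma for the polyhedral epigraph). Convexity then gives `r - m ≤ ⟨u, x - z⟩` for every minimizer
`z`.

The difficulty is that `uᵢ` is not controlled by `vᵢ` as `yᵢ → 0`. The remedy is to take `z` nearest
to `x` in `Ω ∩ S_ρ` with `ρᵢ = |xᵢ - x̄ᵢ|`. Off the support of `x̄` this forces `0 ≤ zᵢ ≤ yᵢ²`, so
with `D = dist(x, z)` one has `|yᵢ² - zᵢ| ≤ min(yᵢ², D) ≤ |yᵢ| √D`. On the support `|yᵢ|` is bounded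
below and a similar bound is immediate (`exists_abs_sq_sub_le`). Hence `r - m ≤ const · √D · ‖v‖`.

Finally `x ∈ S_ρ`, so the hypothesis on `Ω ∩ S_ρ` gives `D ≤ c dist(x, Ω)^γ`, while the KL property
of `φ` yields `dist(x, Ω) ≤ C (r - m)^(1-α)` (`HasKLExponent.exists_infDist_argmin_le`, a smoothed
Ekeland argument). Thus `(r - m)^(1 - γ(1-α)/2) ≤ M ‖v‖`, and this exponent is `(1+β)/2`. -/

theorem le_of_forall_pos_le_add_mul {a b N : ℝ} (h : ∀ ε : ℝ, 0 < ε → a ≤ b + ε * N) : a ≤ b := by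
  have hT : Tendsto (fun ε : ℝ => b + ε * N) (𝓝[>] 0) (𝓝 b) := by
    have : Continuous fun ε : ℝ => b + ε * N := by fun_prop
    simpa using (this.tendsto 0).mono_left nhdsWithin_le_nhds
  exact ge_of_tendsto hT (eventually_mem_nhdsWithin.mono fun ε hε => h ε hε)

/-- **Farkas' lemma** for finitely many linear functionals. -/
theorem exists_nonneg_eq_sum_of_forall_nonpos {ι V : Type*} [AddCommGroup V] [Module ℝ V]
    (s : Finset ι) (a : ι → V →ₗ[ℝ] ℝ) (c : V →ₗ[ℝ] ℝ)
    (h : ∀ x, (∀ j ∈ s, a j x ≤ 0) → c x ≤ 0) :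
    ∃ l : ι → ℝ, (∀ j, 0 ≤ l j) ∧ c = ∑ j ∈ s, l j • a j := by
  classical
  induction s using Finset.induction_on generalizing a c with
  | empty =>
    refine ⟨0, fun _ => le_rfl, ?_⟩
    ext x
    have h1 := h x (by simp)
    have h2 := h (-x) (by simp)
    simp only [map_neg] at h2
    simp
    linarith
  | insert k s hk ih =>
    by_cases hs : ∀ x, (∀ j ∈ s, a j x ≤ 0) → c x ≤ 0
    · obtain ⟨l, hl, hc⟩ := ih a c hs
      refine ⟨fun j => if j = k then 0 else l j, fun j => ?_, ?_⟩
      · dsimp only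
        split_ifs
        exacts [le_rfl, hl j]
      · rw [Finset.sum_insert hk, hc]
        simp only [if_true, zero_smul, zero_add]
        refine Finset.sum_congr rfl fun j hj => ?_
        rw [if_neg (ne_of_mem_of_not_mem hj hk)]
    · push Not at hs
      obtain ⟨x₁, hx₁, hcx₁⟩ := hs
      have hb : 0 < a k x₁ := by
        by_contra hb
        refine absurd (h x₁ fun j hj => ?_) (not_le.2 hcx₁)
        rcases Finset.mem_insert.1 hj with rfl | hj
        exacts [not_lt.1 hb, hx₁ j hj]
      -- Projecting along `x₀` onto `ker (a k)` removes the constraint `k`, so the induction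
      -- hypothesis applies to the projected functionals. The coefficient of `a k` recovered below
      -- is nonnegative because `c x₀ > 0` and every `a i x₀ ≤ 0`.
      set x₀ : V := (a k x₁)⁻¹ • x₁ with hx₀
      have hb0 : a k x₀ = 1 := by simp [hx₀, hb.ne']
      have ha0 : ∀ j ∈ s, a j x₀ ≤ 0 := fun j hj => by
        simpa [hx₀] using mul_nonpos_of_nonneg_of_nonpos (inv_nonneg.2 hb.le) (hx₁ j hj)
      have hc0 : 0 < c x₀ := by simpa [hx₀] using mul_pos (inv_pos.2 hb) hcx₁
      obtain ⟨l, hl, hc⟩ := ih (fun j => a j - a j x₀ • a k) (c - c x₀ • a k) fun x hx => by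
        have := h (x - a k x • x₀) fun j hj => by
          rcases Finset.mem_insert.1 hj with rfl | hj
          · simp [hb0]
          · have := hx j hj
            simp only [LinearMap.sub_apply, LinearMap.smul_apply, smul_eq_mul, map_sub,
              map_smul] at this ⊢
            linarith
        simp only [LinearMap.sub_apply, LinearMap.smul_apply, smul_eq_mul, map_sub,
              map_smul] at this ⊢
        linarith
      refine ⟨fun j => if j = k then c x₀ - ∑ i ∈ s, l i * a i x₀ else l j, fun j => ?_, ?_⟩
      · dsimp only
        split_ifs
        · have := Finset.sum_nonpos fun i hi =>
            mul_nonpos_of_nonneg_of_nonpos (hl i) (ha0 i hi)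
          linarith
        · exact hl j
      · rw [Finset.sum_insert hk]
        have : ∑ j ∈ s, (if j = k then c x₀ - ∑ i ∈ s, l i * a i x₀ else l j) • a j
            = ∑ j ∈ s, l j • a j := Finset.sum_congr rfl fun j hj => by
          rw [if_neg (ne_of_mem_of_not_mem hj hk)]
        simp only [if_true]
        rw [this]
        ext x
        have hcx := LinearMap.congr_fun hc x
        simp only [smul_sub, LinearMap.add_apply, LinearMap.sum_apply, LinearMap.sub_apply,
          LinearMap.smul_apply, smul_eq_mul, Finset.sum_sub_distrib, sub_mul, Finset.sum_mul,
          mul_assoc] at hcx ⊢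
        linear_combination hcx

theorem isClosed_epi {E : Type*} [TopologicalSpace E] {h : E → EReal} (hl : LowerSemicontinuous h) : IsClosed (epi h) :=
  hl.isClosed_epigraph.preimage (f := fun p : E × ℝ => (p.1, (p.2 : EReal)))
    (continuous_fst.prodMk (continuous_coe_real_ereal.comp continuous_snd))

theorem isClosed_argmin {E : Type*} [TopologicalSpace E] {h : E → EReal} (hl : LowerSemicontinuous h) : IsClosed (argmin h) := by
  have : argmin h = ⋂ z, {x | h x ≤ h z} := by ext; simp [argmin]
  rw [this]
  exact isClosed_iInter fun z => hl.isClosed_preimage (h z)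

/-! ### Subgradients, convexity, and the KL inequality on regular subgradients -/

section Subdifferential

variable {E : Type*} [NormedAddCommGroup E] [InnerProductSpace ℝ E]

/-- Testing against real heights `t` of the epigraph avoids extended arithmetic: points with `h z =
⊤` impose no condition. -/
theorem mem_regularSubdiff_iff {h : E → EReal} {x v : E} {r : ℝ} (hr : h x = r) :
    v ∈ regularSubdiff h x ↔ ∀ ε : ℝ, 0 < ε → ∀ᶠ z in 𝓝 x, ∀ t : ℝ, h z ≤ t →
      r + (inner ℝ v (z - x) - ε * ‖z - x‖) ≤ t := by
  have key : ∀ (s : ℝ) (e : EReal), (s : EReal) ≤ e ↔ ∀ t : ℝ, e ≤ t → s ≤ t := fun s e =>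
    ⟨fun h1 t ht => EReal.coe_le_coe_iff.1 (h1.trans ht), fun h1 =>
      EReal.le_of_forall_lt_iff_le.1 fun t ht => EReal.coe_le_coe_iff.2 (h1 t ht.le)⟩
  simp only [regularSubdiff, mem_ofPred_eq, hr, ← EReal.coe_add, key]
  simp

theorem exists_real_of_mem_regularSubdiff {h : E → EReal} {x v : E}
    (hv : v ∈ regularSubdiff h x) : ∃ r : ℝ, h x = r :=
  ⟨(h x).toReal, (EReal.coe_toReal hv.2.1 hv.1).symm⟩

theorem regularSubdiff_subset_subdiff (h : E → EReal) (x : E) :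
    regularSubdiff h x ⊆ subdiff h x := fun v hv =>
  ⟨hv.1, hv.2.1, fun _ => x, fun _ => v, tendsto_const_nhds, tendsto_const_nhds,
    fun _ => hv, tendsto_const_nhds⟩

/-- Regular subgradients of a convex function are global subgradients. -/
theorem IsConvexFun.le_of_mem_regularSubdiff {h : E → EReal} (hc : IsConvexFun h) {x v : E}
    {r : ℝ} (hr : h x = r) (hv : v ∈ regularSubdiff h x) {z : E} {t : ℝ} (ht : h z ≤ t) :
    r + inner ℝ v (z - x) ≤ t := by
  rw [mem_regularSubdiff_iff hr] at hv
  refine le_of_forall_pos_le_add_mul (N := ‖z - x‖) fun ε hε => ?_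
  have hT : Tendsto (fun s : ℝ => x + s • (z - x)) (𝓝[>] 0) (𝓝 x) := by
    have : Continuous fun s : ℝ => x + s • (z - x) := by fun_prop
    simpa using (this.tendsto 0).mono_left nhdsWithin_le_nhds
  have h1 : ∀ᶠ s : ℝ in 𝓝[>] 0, s < 1 :=
    nhdsWithin_le_nhds (Iio_mem_nhds one_pos)
  obtain ⟨s, hs, hs1, hs0⟩ :=
    ((hT.eventually (hv ε hε)).and (h1.and self_mem_nhdsWithin)).exists
  have hs0' : (0 : ℝ) < s := hs0
  -- The local inequality is applied at a point of the segment from `x` to `z`, where convexity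
  -- bounds `h` by the chord; dividing by `s` makes it global.
  have hmem := hc (x := (x, r)) (y := (z, t)) (by simp [epi, hr]) (by simpa [epi] using ht)
    (a := 1 - s) (b := s) (by linarith) hs0'.le (by ring)
  have hpt : (1 - s) • x + s • z = x + s • (z - x) := by
    rw [sub_smul, smul_sub, one_smul]; abel
  have := hs ((1 - s) * r + s * t) (by simpa [epi, hpt] using hmem)
  rw [add_sub_cancel_left, inner_smul_right, norm_smul, Real.norm_of_nonneg hs0'.le] at this
  have : s * (r + inner ℝ v (z - x)) ≤ s * (t + ε * ‖z - x‖) := by linarith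
  exact le_of_mul_le_mul_left this hs0'

/-- Stationary points of a convex function are global minimizers. -/
theorem IsConvexFun.mem_argmin_of_isStationary {h : E → EReal} (hc : IsConvexFun h) {x : E}
    (hx : IsStationary h x) : x ∈ argmin h := by
  obtain ⟨hb, ht, xs, vs, hxs, hhs, hvs, hv⟩ := hx
  intro z
  refine EReal.le_of_forall_lt_iff_le.1 fun t hzt => ?_
  have h1 : ∀ k, h (xs k) ≤ ((t - inner ℝ (vs k) (z - xs k) : ℝ) : EReal) := fun k => by
    obtain ⟨r, hr⟩ := exists_real_of_mem_regularSubdiff (hvs k)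
    have := hc.le_of_mem_regularSubdiff hr (hvs k) hzt.le
    rw [hr, EReal.coe_le_coe_iff]
    linarith
  have h2 : Tendsto (fun k => ((t - inner ℝ (vs k) (z - xs k) : ℝ) : EReal)) atTop
      (𝓝 (t : ℝ)) := by
    refine (continuous_coe_real_ereal.tendsto _).comp ?_
    simpa using (tendsto_const_nhds (x := t)).sub (hv.inner (tendsto_const_nhds.sub hxs))
  exact le_of_tendsto_of_tendsto' hhs h2 h1

/-- The gradient of a differentiable minorant touching `h` at `x` is a regular subgradient. -/
theorem mem_regularSubdiff_of_minorant {h : E → EReal} {x v : E} {k : E → ℝ}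
    (hk : HasFDerivAt k (innerSL ℝ v) x) (hx : h x = k x) (hle : ∀ᶠ z in 𝓝 x, (k z : EReal) ≤ h z) :
    v ∈ regularSubdiff h x := by
  rw [mem_regularSubdiff_iff hx]
  intro ε hε
  filter_upwards [hle, hk.isLittleO.def hε] with z hz hz' t ht
  have h1 : k z ≤ t := EReal.coe_le_coe_iff.1 (hz.trans ht)
  rw [innerSL_apply_apply, Real.norm_eq_abs] at hz'
  have := (abs_le.1 hz').1
  linarith

theorem zero_mem_regularSubdiff_of_mem_argmin {h : E → EReal} {x : E} {r : ℝ} (hr : h x = r)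
    (hx : x ∈ argmin h) : (0 : E) ∈ regularSubdiff h x :=
  mem_regularSubdiff_of_minorant (k := fun _ => r) (by simpa using hasFDerivAt_const r x) hr
    (Eventually.of_forall fun z => hr ▸ hx z)

/-- The Kurdyka-Łojasiewicz inequality read on regular subgradients only, in real terms. -/
theorem HasKLExponent.exists_regular {h : E → EReal} {x : E} {α m : ℝ}
    (hKL : HasKLExponent h x α) (hm : h x = m) :
    ∃ c : ℝ, 0 < c ∧ ∃ a : ℝ, 0 < a ∧ ∃ V ∈ 𝓝 x, ∀ z ∈ V, ∀ r : ℝ, h z = r → m < r → r < m + a →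
      ∀ v ∈ regularSubdiff h z, (r - m) ^ α ≤ c * ‖v‖ := by
  obtain ⟨-, -, -, -, h1, c, hc, a, ha, V, hV, H⟩ := hKL
  obtain ⟨a', ha'0, ha'⟩ := EReal.lt_iff_exists_real_btwn.1 ha
  refine ⟨c * (1 - α), mul_pos hc (by linarith), a', by exact_mod_cast ha'0, V, hV, ?_⟩
  intro z hz r hr hmr hra v hv
  have hsub : h z - h x = ((r - m : ℝ) : EReal) := by rw [hr, hm, EReal.coe_sub]
  have := H z hz (by rw [hsub]; exact_mod_cast sub_pos.2 hmr)
    (by rw [hsub]; exact lt_trans (by exact_mod_cast (by linarith)) ha')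
  rw [hsub, EReal.toReal_coe] at this
  have hp : 0 < (r - m) ^ α := Real.rpow_pos_of_pos (sub_pos.2 hmr) _
  have hle : Metric.infEDist 0 (subdiff h z) ≤ ENNReal.ofReal ‖v‖ := by
    refine (Metric.infEDist_le_edist_of_mem (regularSubdiff_subset_subdiff h z hv)).trans ?_
    rw [edist_dist, dist_zero_left]
  have h2 := this.trans (mul_le_mul_right hle _)
  rw [← ENNReal.ofReal_mul' (norm_nonneg v), ENNReal.one_le_ofReal,
    Real.rpow_neg (sub_pos.2 hmr).le] at h2
  have h3 := mul_le_mul_of_nonneg_right h2 hp.le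
  field_simp at h3
  linarith

/-- The Kurdyka-Łojasiewicz property follows from its inequality on regular subgradients. -/
theorem hasKLExponent_of_regular {h : E → EReal} {x : E} {α m : ℝ} (hp : IsProper h)
    (hl : LowerSemicontinuous h) (hx : x ∈ domSubdiff h) (hα₀ : 0 ≤ α) (hα₁ : α < 1)
    (hm : h x = m) {c a : ℝ} (hc : 0 < c) (ha : 0 < a) {V : Set E} (hV : V ∈ 𝓝 x)
    (H : ∀ z ∈ V, ∀ r : ℝ, h z = r → m < r → r < m + a →
      ∀ v ∈ regularSubdiff h z, (r - m) ^ α ≤ c * ‖v‖) :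
    HasKLExponent h x α := by
  have hα : 0 < 1 - α := by linarith
  -- The division cancels the factor `1 - α` in the definition. The interior of `V` is used because
  -- limiting subgradients at `z` come from nearby points, which must also lie in `V`.
  refine ⟨hp, hl, hx, hα₀, hα₁, c / (1 - α), div_pos hc hα, a, by exact_mod_cast ha,
    interior V, interior_mem_nhds.2 hV, ?_⟩
  intro z hz h0 h1
  by_cases hfin : h z = ⊤
  · rw [hfin, hm, EReal.top_sub_coe] at h1
    exact absurd h1 (by simp)
  obtain ⟨r, hr⟩ : ∃ r : ℝ, h z = r := ⟨_, (EReal.coe_toReal hfin (hp.2 z).ne').symm⟩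
  have hsub : h z - h x = ((r - m : ℝ) : EReal) := by rw [hr, hm, EReal.coe_sub]
  rw [hsub] at h0 h1 ⊢
  have h0' : 0 < r - m := by exact_mod_cast h0
  have h1' : r - m < a := by exact_mod_cast h1
  have hpow : 0 < (r - m) ^ α := Real.rpow_pos_of_pos h0' _
  have hdist : ENNReal.ofReal ((r - m) ^ α / c) ≤ Metric.infEDist 0 (subdiff h z) := by
    refine Metric.le_infEDist.2 fun v hv => ?_
    rw [edist_dist, dist_zero_left]
    refine ENNReal.ofReal_le_ofReal ?_
    rw [div_le_iff₀' hc]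
    obtain ⟨-, -, zs, vs, hzs, hhs, hvs, hvt⟩ := hv
    choose rs hrs using fun k => exists_real_of_mem_regularSubdiff (hvs k)
    have hrt : Tendsto rs atTop (𝓝 r) := by
      rw [hr] at hhs
      simp only [hrs] at hhs
      exact EReal.tendsto_coe.1 hhs
    refine le_of_tendsto_of_tendsto ((hrt.sub_const m).rpow_const (Or.inl h0'.ne'))
      (hvt.norm.const_mul c) ?_
    filter_upwards [hzs.eventually (isOpen_interior.mem_nhds hz),
      hrt.eventually (Ioo_mem_nhds (sub_pos.1 h0') (sub_lt_iff_lt_add'.1 h1'))] with k hk hk'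
    exact H _ (interior_subset hk) _ (hrs k) hk'.1 hk'.2 _ (hvs k)
  refine le_trans ?_ (mul_le_mul_right hdist _)
  rw [← ENNReal.ofReal_mul' (by positivity), ENNReal.one_le_ofReal, EReal.toReal_coe,
    Real.rpow_neg h0'.le]
  apply le_of_eq
  field_simp

end Subdifferential

/-! ### From the KL property to an error bound -/

section ErrorBound

variable {E : Type*} [NormedAddCommGroup E] [InnerProductSpace ℝ E]

/-- The gradient of `z ↦ m + (A - l (√(d² + ‖z - x‖²) - √(d² + ‖z₀ - x‖²))) ^ p` at `z₀`. -/
theorem hasFDerivAt_rpow_sub_sqrt (x z₀ : E) {m A l d p : ℝ} (hA : 0 < A) (hd : 0 < d)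
    (hl : 0 ≤ l) (hp : 0 ≤ p) :
    ∃ v : E, ‖v‖ ≤ l * p * A ^ (p - 1) ∧
      HasFDerivAt (fun z : E => m + (A - l * (√(d ^ 2 + ‖z - x‖ ^ 2) -
        √(d ^ 2 + ‖z₀ - x‖ ^ 2))) ^ p) (innerSL ℝ v) z₀ := by
  set S := √(d ^ 2 + ‖z₀ - x‖ ^ 2) with hS
  have hpos : 0 < d ^ 2 + ‖z₀ - x‖ ^ 2 := by positivity
  have hSpos : 0 < S := Real.sqrt_pos.2 hpos
  have hAp : 0 < A ^ (p - 1) := Real.rpow_pos_of_pos hA _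
  have hN : HasFDerivAt (fun z : E => ‖z - x‖ ^ 2) (2 • innerSL ℝ (z₀ - x)) z₀ := by
    have := ((hasFDerivAt_id (𝕜 := ℝ) z₀).sub_const x).norm_sq
    simpa using this
  have hH : HasDerivAt (fun t : ℝ => m + (A - l * (√(d ^ 2 + t) - S)) ^ p)
      (-(l * (1 / (2 * S))) * p * A ^ (p - 1)) (‖z₀ - x‖ ^ 2) := by
    have h1 : HasDerivAt (fun t : ℝ => √(d ^ 2 + t)) (1 / (2 * S)) (‖z₀ - x‖ ^ 2) :=
      ((hasDerivAt_id _).const_add (d ^ 2)).sqrt hpos.ne'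
    have h2 := ((h1.sub_const S).const_mul l).const_sub A
    have h3 := (h2.rpow_const (p := p) (Or.inl (by simp [← hS, hA.ne']))).const_add m
    simpa [← hS] using h3
  refine ⟨(2 * (-(l * (1 / (2 * S))) * p * A ^ (p - 1))) • (z₀ - x), ?_, ?_⟩
  · have hle : ‖z₀ - x‖ ≤ S := Real.le_sqrt_of_sq_le (by nlinarith)
    have : 2 * (-(l * (1 / (2 * S))) * p * A ^ (p - 1)) = -(l * p * A ^ (p - 1) / S) := by
      field_simp
    rw [norm_smul, this, norm_neg, Real.norm_of_nonneg (by positivity), div_mul_eq_mul_div,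
      div_le_iff₀ hSpos]
    gcongr
  · have := hH.comp_hasFDerivAt z₀ hN
    refine this.congr_fderiv ?_
    ext w
    simp
    ring

/-- A smoothed Ekeland-type principle for `(h - m) ^ (1 - α)`. -/
theorem exists_near_regularSubdiff [ProperSpace E] {h : E → EReal} (hlsc : LowerSemicontinuous h)
    {α m r l d R : ℝ} {x x₀ : E} (hα₁ : α < 1) (hm : ∀ z, (m : EReal) ≤ h z)
    (hx : h x = r) (hl : 0 < l) (hd : 0 < d) (hR : (r - m) ^ (1 - α) / l + d + dist x x₀ < R) :
    ∃ z ∈ Metric.ball x₀ R, ∃ s : ℝ, h z = s ∧ s ≤ r ∧ dist x z ≤ (r - m) ^ (1 - α) / l + d ∧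
      (s = m ∨ ∃ v ∈ regularSubdiff h z, ‖v‖ ≤ l * (1 - α)⁻¹ * (s - m) ^ α) := by
  have hα : 0 < 1 - α := by linarith
  have hmr : m ≤ r := by have := hm x; rw [hx] at this; exact_mod_cast this
  have hF0 : 0 ≤ (r - m) ^ (1 - α) := Real.rpow_nonneg (sub_nonneg.2 hmr) _
  -- A smooth substitute for `‖z - x‖`: `d > 0` makes it differentiable at `x` too, at the cost of
  -- the extra `d` in the distance bound.
  set ψ : E → ℝ := fun z => √(d ^ 2 + ‖z - x‖ ^ 2) with hψ
  have hψd : ∀ z, d ≤ ψ z := fun z => Real.le_sqrt_of_sq_le (by nlinarith [sq_nonneg ‖z - x‖])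
  have hψn : ∀ z, ‖z - x‖ ≤ ψ z := fun z => Real.le_sqrt_of_sq_le (by nlinarith)
  have hψx : ψ x = d := by simp [hψ, Real.sqrt_sq hd.le]
  have hψc : Continuous ψ := by fun_prop
  -- The penalized function lives on the epigraph, where it is continuous although `h` is only lower
  -- semicontinuous.
  set Q : E × ℝ → ℝ := fun p => (p.2 - m) ^ (1 - α) + l * ψ p.1 with hQ
  have hQc : Continuous Q := by
    have h1 : Continuous fun p : E × ℝ => (p.2 - m) ^ (1 - α) :=
      (by fun_prop : Continuous fun p : E × ℝ => p.2 - m).rpow_const fun _ => Or.inr hα.le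
    exact h1.add (by fun_prop)
  have hxR : x ∈ Metric.closedBall x₀ R := by
    rw [Metric.mem_closedBall]
    have : 0 ≤ (r - m) ^ (1 - α) / l := by positivity
    linarith
  have hK : IsCompact ((Metric.closedBall x₀ R ×ˢ Icc m r) ∩ epi h) :=
    ((isCompact_closedBall x₀ R).prod isCompact_Icc).inter_right (isClosed_epi hlsc)
  have hxK : (x, r) ∈ (Metric.closedBall x₀ R ×ˢ Icc m r) ∩ epi h :=
    ⟨⟨hxR, hmr, le_rfl⟩, by simp [epi, hx]⟩
  obtain ⟨⟨z, s⟩, ⟨⟨hzR, hms, hsr⟩, hzs⟩, hmin⟩ := hK.exists_isMinOn ⟨_, hxK⟩ hQc.continuousOn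
  have hQx : Q (z, s) ≤ (r - m) ^ (1 - α) + l * d := by
    have := hmin hxK
    simpa [hQ, hψx] using this
  have hms' : m ≤ s := hms
  have hA0 : 0 ≤ (s - m) ^ (1 - α) := Real.rpow_nonneg (sub_nonneg.2 hms') _
  have hdist : dist x z ≤ (r - m) ^ (1 - α) / l + d := by
    rw [dist_comm, dist_eq_norm]
    refine le_of_mul_le_mul_left ?_ hl
    have h1 := mul_le_mul_of_nonneg_left (hψn z) hl.le
    have h2 : l * ((r - m) ^ (1 - α) / l + d) = (r - m) ^ (1 - α) + l * d := by
      field_simp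
    have h3 : Q (z, s) = (s - m) ^ (1 - α) + l * ψ z := rfl
    linarith
  have hzball : z ∈ Metric.ball x₀ R := by
    rw [Metric.mem_ball]
    have := dist_triangle_left z x₀ x
    linarith
  have hzs' : h z ≤ s := hzs
  -- The minimizer lies on the graph: lowering `s` to `h z` would strictly decrease `Q`.
  have hz : h z = s := by
    obtain ⟨s', hs'⟩ : ∃ s' : ℝ, h z = s' :=
      ⟨_, (EReal.coe_toReal (hzs'.trans_lt (EReal.coe_lt_top s)).ne
        ((EReal.bot_lt_coe m).trans_le (hm z)).ne').symm⟩
    have h1 : m ≤ s' := by have := hm z; rw [hs'] at this; exact_mod_cast this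
    have h2 : s' ≤ s := by rw [hs'] at hzs'; exact_mod_cast hzs'
    have h3 : Q (z, s) ≤ Q (z, s') := hmin ⟨⟨hzR, h1, h2.trans hsr⟩, by simp [epi, hs']⟩
    have h4 : (s - m) ^ (1 - α) ≤ (s' - m) ^ (1 - α) := by simpa [hQ] using h3
    rw [Real.rpow_le_rpow_iff (by linarith) (by linarith) hα] at h4
    rw [hs', le_antisymm h2 (by linarith)]
  refine ⟨z, hzball, s, hz, hsr, hdist, ?_⟩
  rcases hms'.eq_or_lt with hs | hs
  · exact Or.inl hs.symm
  right
  set A := (s - m) ^ (1 - α) with hAdef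
  have hA : 0 < A := Real.rpow_pos_of_pos (sub_pos.2 hs) _
  obtain ⟨v, hv, hderiv⟩ := hasFDerivAt_rpow_sub_sqrt x z (m := m) hA hd hl.le
    (inv_nonneg.2 hα.le)
  refine ⟨v, mem_regularSubdiff_of_minorant hderiv ?_ ?_, ?_⟩
  · rw [hz, sub_self, mul_zero, sub_zero, hAdef, Real.rpow_rpow_inv (by linarith) hα.ne']
    congr 1
    ring
  · have hbase : ∀ᶠ z' in 𝓝 z, 0 < A - l * (ψ z' - ψ z) := by
      have : Continuous fun z' => A - l * (ψ z' - ψ z) := by fun_prop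
      refine this.tendsto z |>.eventually (lt_mem_nhds ?_)
      simpa using hA
    filter_upwards [hbase, Metric.isOpen_ball.mem_nhds hzball] with z' hz' hz'R
    refine EReal.le_of_forall_lt_iff_le.1 fun t ht => ?_
    have hmt : m ≤ t := by exact_mod_cast (hm z').trans ht.le
    have hle : A - l * (ψ z' - ψ z) ≤ (t - m) ^ (1 - α) := by
      rcases le_total t r with htr | htr
      · have : Q (z, s) ≤ Q (z', t) :=
          hmin ⟨⟨Metric.ball_subset_closedBall hz'R, hmt, htr⟩, ht.le⟩
        simp only [hQ] at this
        linarith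
      -- Heights above `r` lie outside the compact set, but there the comparison with the value of
      -- `Q` at `(x, r)` suffices, since `ψ` is smallest at `x`.
      · have h1 : (r - m) ^ (1 - α) ≤ (t - m) ^ (1 - α) :=
          Real.rpow_le_rpow (by linarith) (by linarith) hα.le
        have h2 := mul_le_mul_of_nonneg_left (hψd z') hl.le
        have h3 : Q (z, s) = A + l * ψ z := rfl
        linarith
    have := Real.rpow_le_rpow hz'.le hle (inv_nonneg.2 hα.le)
    rw [Real.rpow_rpow_inv (by linarith) hα.ne'] at this
    rw [EReal.coe_le_coe_iff]
    simp only [hψ] at this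
    linarith
  · have : A ^ ((1 - α)⁻¹ - 1) = (s - m) ^ α := by
      rw [hAdef, ← Real.rpow_mul (by linarith)]
      congr 1
      field_simp
      ring
    rwa [this] at hv

/-- The Kurdyka-Łojasiewicz property at a global minimizer yields a local error bound. -/
theorem HasKLExponent.exists_infDist_argmin_le [ProperSpace E] {h : E → EReal} {x₀ : E} {α m : ℝ}
    (hKL : HasKLExponent h x₀ α) (hx₀ : x₀ ∈ argmin h) (hm : h x₀ = m) :
    ∃ C : ℝ, 0 < C ∧ ∃ a : ℝ, 0 < a ∧ ∃ V ∈ 𝓝 x₀, ∀ x ∈ V, ∀ r : ℝ, h x = r → r < m + a →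
      Metric.infDist x (argmin h) ≤ C * (r - m) ^ (1 - α) := by
  obtain ⟨c, hc, a, ha, V, hV, H⟩ := hKL.exists_regular hm
  have hα₁ : α < 1 := hKL.2.2.2.2.1
  have hα : 0 < 1 - α := by linarith
  obtain ⟨R, hR, hRV⟩ := Metric.mem_nhds_iff.1 hV
  have hmin : ∀ z, (m : EReal) ≤ h z := fun z => hm ▸ hx₀ z
  -- Half the lower bound `(1 - α) / c` that KL puts on the slope of `(h - m) ^ (1 - α)`; the
  -- approximate minimizer found below is then forced to be a true one.
  set l : ℝ := (1 - α) / (2 * c) with hldef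
  have hl : 0 < l := by positivity
  -- The second bound gives `(r - m) ^ (1 - α) / l ≤ R / 4`; with `d < R / 4` and `x` within `R / 2`
  -- of `x₀`, the search stays in the ball of radius `R`.
  refine ⟨1 / l, by positivity, min a ((l * (R / 4)) ^ (1 - α)⁻¹),
    lt_min ha (Real.rpow_pos_of_pos (by positivity) _), Metric.ball x₀ (R / 2),
    Metric.ball_mem_nhds _ (by positivity), ?_⟩
  intro x hx r hr hra
  have hmr : m ≤ r := by have := hmin x; rw [hr] at this; exact_mod_cast this
  have hF : (r - m) ^ (1 - α) / l ≤ R / 4 := by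
    rw [div_le_iff₀' hl, ← Real.rpow_inv_rpow (x := l * (R / 4)) (by positivity) hα.ne']
    refine Real.rpow_le_rpow (by linarith) ?_ hα.le
    have := min_le_right a ((l * (R / 4)) ^ (1 - α)⁻¹)
    linarith
  have key : ∀ d ∈ Ioo 0 (R / 4), Metric.infDist x (argmin h) ≤ (r - m) ^ (1 - α) / l + d := by
    intro d hd
    obtain ⟨z, hzR, s, hz, hsr, hdist, hs⟩ := exists_near_regularSubdiff hKL.2.1 (x := x) (x₀ := x₀)
      (R := R) hα₁ hmin hr hl hd.1 (by have := Metric.mem_ball.1 hx; have := hd.2; linarith)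
    refine (Metric.infDist_le_dist_of_mem ?_).trans hdist
    have hms : m ≤ s := by have := hmin z; rw [hz] at this; exact_mod_cast this
    rcases hms.eq_or_lt with rfl | hms
    · exact fun w => hz ▸ hmin w
    obtain ⟨v, hv, hvn⟩ := hs.resolve_left hms.ne'
    exfalso
    have hpow : 0 < (s - m) ^ α := Real.rpow_pos_of_pos (sub_pos.2 hms) _
    have h1 := H z (hRV hzR) s hz hms
      (by have := min_le_left a ((l * (R / 4)) ^ (1 - α)⁻¹); linarith) v hv
    have h2 : c * ‖v‖ ≤ c * (l * (1 - α)⁻¹ * (s - m) ^ α) := by gcongr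
    have h3 : c * (l * (1 - α)⁻¹ * (s - m) ^ α) = (s - m) ^ α / 2 := by
      rw [hldef]; field_simp
    linarith
  have hT : Tendsto (fun d : ℝ => (r - m) ^ (1 - α) / l + d) (𝓝[>] 0)
      (𝓝 ((r - m) ^ (1 - α) / l)) := by
    have : Continuous fun d : ℝ => (r - m) ^ (1 - α) / l + d := by fun_prop
    simpa using (this.tendsto 0).mono_left nhdsWithin_le_nhds
  have := ge_of_tendsto hT (mem_of_superset (Ioo_mem_nhdsGT (by positivity : (0 : ℝ) < R / 4)) key)
  rwa [one_div_mul_eq_div]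

end ErrorBound

/-! ### Chain rule for the squared reparameterization -/

theorem coe_add_le_coe_iff {a t : ℝ} {e : EReal} :
    (a : EReal) + e ≤ t ↔ e ≤ ((t - a : ℝ) : EReal) := by
  induction e with
  | bot => simp
  | top => simp [-EReal.coe_sub]
  | coe e =>
    rw [← EReal.coe_add, EReal.coe_le_coe_iff, EReal.coe_le_coe_iff, le_sub_iff_add_le']

theorem exists_real_of_coe_add_eq {a t : ℝ} {e : EReal} (h : (a : EReal) + e = t) :
    e = ((t - a : ℝ) : EReal) := by
  induction e with
  | bot => simp at h
  | top => simp at h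
  | coe e =>
    rw [← EReal.coe_add, EReal.coe_eq_coe_iff] at h
    rw [EReal.coe_eq_coe_iff]
    linarith

variable {n : ℕ}

theorem continuous_sqVec : Continuous (sqVec (n := n)) := by
  unfold sqVec
  refine (PiLp.continuous_toLp 2 _).comp ?_
  fun_prop

/-- The inequality between directional derivatives along the curves
`s ↦ y √(1 + s d / y²)`, whose squares are the segments `s ↦ y² + s d`. -/
theorem inner_le_of_mem_regularSubdiff_bigPhi {f : EuclideanSpace ℝ (Fin n) → ℝ}
    {g : EuclideanSpace ℝ (Fin n) → EReal} {y v : EuclideanSpace ℝ (Fin n)}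
    {f' : EuclideanSpace ℝ (Fin n) →L[ℝ] ℝ} (hf : HasFDerivAt f f' (sqVec y)) {G : ℝ}
    (hG : g (sqVec y) = G) (hv : v ∈ regularSubdiff (bigPhi f g) y)
    {d : EuclideanSpace ℝ (Fin n)} (hd : ∀ i, y i = 0 → d i = 0) {τ : ℝ}
    (hτ : ∀ᶠ s : ℝ in 𝓝[>] 0, g (sqVec y + s • d) ≤ ((G + s * τ : ℝ) : EReal)) :
    ∑ i, v i / (2 * y i) * d i ≤ f' d + τ := by
  -- Where `y i = 0` the convention `d i / 0 = 0` is harmless: the coordinate stays zero, in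
  -- agreement with `d i = 0`.
  set Y : ℝ → EuclideanSpace ℝ (Fin n) :=
    fun s => WithLp.toLp 2 fun i => y i * √(1 + s * (d i / y i ^ 2)) with hY
  set Y' : EuclideanSpace ℝ (Fin n) := WithLp.toLp 2 fun i => d i / (2 * y i) with hY'
  have hY0 : Y 0 = y := by ext i; simp [hY]
  have hYd : HasDerivAt Y Y' 0 := by
    have h1 : HasDerivAt (fun (s : ℝ) (i : Fin n) => y i * √(1 + s * (d i / y i ^ 2)))
        (fun i => d i / (2 * y i)) 0 := by
      rw [hasDerivAt_pi]
      intro i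
      have h2 : HasDerivAt (fun s : ℝ => 1 + s * (d i / y i ^ 2)) (d i / y i ^ 2) 0 := by
        simpa using ((hasDerivAt_id (0 : ℝ)).mul_const (d i / y i ^ 2)).const_add 1
      have h3 := (h2.sqrt (by simp)).const_mul (y i)
      refine h3.congr_deriv ?_
      rcases eq_or_ne (y i) 0 with h0 | h0
      · simp [h0]
      · rw [zero_mul, add_zero, Real.sqrt_one]
        field_simp
    exact ((PiLp.continuousLinearEquiv 2 ℝ (fun _ : Fin n => ℝ)).symm.hasFDerivAt
      (x := fun i : Fin n => y i * √(1 + 0 * (d i / y i ^ 2)))).comp_hasDerivAt (0 : ℝ) h1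
  have hsq : ∀ᶠ s : ℝ in 𝓝[>] 0, sqVec (Y s) = sqVec y + s • d := by
    have h1 : ∀ᶠ s : ℝ in 𝓝 0, ∀ i, 0 < 1 + s * (d i / y i ^ 2) := by
      refine eventually_all.2 fun i => ?_
      have : Continuous fun s : ℝ => 1 + s * (d i / y i ^ 2) := by fun_prop
      exact (this.tendsto 0).eventually (lt_mem_nhds (by simp))
    filter_upwards [nhdsWithin_le_nhds h1] with s hs
    ext i
    simp only [hY, sqVec, PiLp.add_apply, PiLp.smul_apply, smul_eq_mul]
    rw [mul_pow, Real.sq_sqrt (hs i).le]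
    rcases eq_or_ne (y i) 0 with h0 | h0
    · simp [h0, hd i h0]
    · field_simp
  have hslopeY := hYd.tendsto_slope_zero_right
  simp only [zero_add, hY0] at hslopeY
  have hfd : HasDerivAt (fun s : ℝ => f (sqVec y + s • d)) (f' d) 0 := by
    have h1 : HasDerivAt (fun s : ℝ => sqVec y + s • d) d 0 := by
      simpa using ((hasDerivAt_id (0 : ℝ)).smul_const d).const_add (sqVec y)
    have hf0 : HasFDerivAt f f' (sqVec y + (0 : ℝ) • d) := by simpa using hf
    exact hf0.comp_hasDerivAt (0 : ℝ) h1
  have hslopef := hfd.tendsto_slope_zero_right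
  simp only [zero_add, zero_smul, add_zero] at hslopef
  have hr : bigPhi f g y = ((f (sqVec y) + G : ℝ) : EReal) := by
    rw [bigPhi, hG, EReal.coe_add]
  rw [mem_regularSubdiff_iff hr] at hv
  have hinner : inner ℝ v Y' = ∑ i, v i / (2 * y i) * d i := by
    rw [PiLp.inner_apply]
    refine Finset.sum_congr rfl fun i _ => ?_
    simp [hY']
    ring
  rw [← hinner]
  refine le_of_forall_pos_le_add_mul (N := ‖Y'‖) fun ε hε => ?_
  have hYt : Tendsto Y (𝓝[>] 0) (𝓝 y) := by
    have := hYd.continuousAt.tendsto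
    rw [hY0] at this
    exact this.mono_left nhdsWithin_le_nhds
  refine le_of_tendsto_of_tendsto ((tendsto_const_nhds (x := v)).inner hslopeY)
    ((hslopef.add_const τ).add (hslopeY.norm.const_mul ε)) ?_
  filter_upwards [hτ, hsq, hYt.eventually (hv ε hε), self_mem_nhdsWithin] with s h1 h2 h3 hs
  have hs0 : (0 : ℝ) < s := hs
  have h4 := h3 (f (sqVec y + s • d) + (G + s * τ)) (by
    rw [bigPhi, h2, EReal.coe_add]
    gcongr)
  rw [inner_smul_right, norm_smul, Real.norm_of_nonneg (inv_nonneg.2 hs0.le), smul_eq_mul]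
  refine le_of_mul_le_mul_left ?_ hs0
  field_simp
  linarith

/-- Subgradients of the squared reparameterization come from subgradients of the original
function; polyhedrality of `g` makes a constraint qualification unnecessary. -/
theorem exists_mem_regularSubdiff_phi {f : EuclideanSpace ℝ (Fin n) → ℝ}
    {g : EuclideanSpace ℝ (Fin n) → EReal} (hf : Differentiable ℝ f) (hg : IsPolyhedralFun g)
    {y v : EuclideanSpace ℝ (Fin n)} (hv : v ∈ regularSubdiff (bigPhi f g) y) :
    ∃ u ∈ regularSubdiff (phi f g) (sqVec y), ∀ i, y i ≠ 0 → 2 * y i * u i = v i := by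
  classical
  obtain ⟨r, hr⟩ := exists_real_of_mem_regularSubdiff hv
  set x := sqVec y with hx
  obtain ⟨G, hG⟩ : ∃ G : ℝ, g x = G := ⟨_, exists_real_of_coe_add_eq hr⟩
  obtain ⟨m, a, b, hab⟩ := hg
  have hepi : ∀ (z : EuclideanSpace ℝ (Fin n)) (t : ℝ), g z ≤ t ↔ ∀ j, a j (z, t) ≤ b j :=
    fun z t => Set.ext_iff.1 hab (z, t)
  set f' := fderiv ℝ f x
  have hf' : HasFDerivAt f f' x := (hf x).hasFDerivAt
  set w : EuclideanSpace ℝ (Fin n) := WithLp.toLp 2 fun i => v i / (2 * y i) with hw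
  let P : EuclideanSpace ℝ (Fin n) →ₗ[ℝ] EuclideanSpace ℝ (Fin n) :=
    { toFun := fun d => WithLp.toLp 2 fun i => if y i = 0 then 0 else d i
      map_add' := fun d e => by ext i; simp; split_ifs <;> simp
      map_smul' := fun c d => by ext i; simp }
  have hP : ∀ d i, P d i = if y i = 0 then 0 else d i := fun d i => rfl
  let Q := P.prodMap (LinearMap.id (R := ℝ) (M := ℝ))
  let c₀ : EuclideanSpace ℝ (Fin n) × ℝ →ₗ[ℝ] ℝ :=
    ((innerSL ℝ w - f' : EuclideanSpace ℝ (Fin n) →L[ℝ] ℝ) : EuclideanSpace ℝ (Fin n) →ₗ[ℝ] ℝ) ∘ₗ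
      LinearMap.fst ℝ _ _ - LinearMap.snd ℝ _ _
  have hc₀ : ∀ d τ, c₀ (d, τ) = inner ℝ w d - f' d - τ := fun d τ => by simp [c₀]
  -- Only constraints active at `(x, G)` restrict small steps into the epigraph. The curve
  -- inequality covers directions supported where `y i ≠ 0`, hence the composition with the
  -- projection `Q`.
  obtain ⟨l, hl, hlA⟩ := exists_nonneg_eq_sum_of_forall_nonpos
    (Finset.univ.filter fun j => a j (x, G) = b j) (fun j => a j ∘ₗ Q) (c₀ ∘ₗ Q) (by
    rintro ⟨d, τ⟩ hdτ
    have hQ : Q (d, τ) = (P d, τ) := rfl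
    simp only [LinearMap.comp_apply, hQ, Finset.mem_filter, Finset.mem_univ, true_and] at hdτ ⊢
    rw [hc₀]
    have := inner_le_of_mem_regularSubdiff_bigPhi hf' hG hv (d := P d) (τ := τ)
      (fun i hi => by rw [hP, if_pos hi]) (by
      simp only [hepi]
      refine eventually_all.2 fun j => ?_
      have hexp : ∀ s : ℝ, a j (x + s • P d, G + s * τ) = a j (x, G) + s * a j (P d, τ) :=
        fun s => by
          rw [← smul_eq_mul s (a j _), ← LinearMap.map_smul (a j), ← LinearMap.map_add (a j)]; rfl
      simp only [← hx, hexp]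
      have hle : a j (x, G) ≤ b j := (hepi x G).1 hG.le j
      rcases hle.eq_or_lt with hj | hj
      · filter_upwards [self_mem_nhdsWithin] with s hs
        have := mul_nonpos_of_nonneg_of_nonpos (le_of_lt hs) (hdτ j hj)
        linarith
      · have hcont : Continuous fun s : ℝ => a j (x, G) + s * a j (P d, τ) := by fun_prop
        exact nhdsWithin_le_nhds (((hcont.tendsto 0).eventually
          (gt_mem_nhds (by simpa using hj))).mono fun s hs => hs.le))
    have hin : inner ℝ w (P d) = ∑ i, v i / (2 * y i) * (P d) i := by
      rw [PiLp.inner_apply]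
      refine Finset.sum_congr rfl fun i _ => ?_
      simp [hw]
      ring
    rw [hin]
    linarith)
  -- The same multipliers without the projection: `A` is nonpositive on every displacement from `(x,
  -- G)` into the epigraph, in all coordinates, and agrees with `c₀` on the support of `y`. This
  -- extension supplies `u i` where `y i = 0`.
  set A : EuclideanSpace ℝ (Fin n) × ℝ →ₗ[ℝ] ℝ :=
    ∑ j ∈ Finset.univ.filter (fun j => a j (x, G) = b j), l j • a j with hA
  have hAQ : ∀ d τ, c₀ (P d, τ) = A (P d, τ) := fun d τ => by
    have := LinearMap.congr_fun hlA (d, τ)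
    simp only [LinearMap.sum_apply, LinearMap.smul_apply, LinearMap.comp_apply] at this
    simpa [hA, Q] using this
  have hA1 : A (0, 1) = -1 := by
    have := hAQ 0 1
    rw [map_zero, hc₀] at this
    simpa using this.symm
  have hAsplit : ∀ d τ, A (d, τ) = A (d, 0) - τ := fun d τ => by
    have : ((d, τ) : EuclideanSpace ℝ (Fin n) × ℝ) = (d, 0) + τ • (0, 1) := by simp
    rw [this, map_add, map_smul, hA1]
    simp
    ring
  let q : EuclideanSpace ℝ (Fin n) →L[ℝ] ℝ :=
    f' + LinearMap.toContinuousLinearMap (A ∘ₗ LinearMap.inl ℝ _ _)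
  have hq : ∀ d, q d = f' d + A (d, 0) := fun d => rfl
  set u := (InnerProductSpace.toDual ℝ _).symm q with hu
  have hud : ∀ d, inner ℝ u d = f' d + A (d, 0) := fun d => by
    rw [hu, InnerProductSpace.toDual_symm_apply, hq]
  refine ⟨u, ?_, fun i hi => ?_⟩
  · have hphi : phi f g x = ((f x + G : ℝ) : EReal) := by rw [phi, hG, EReal.coe_add]
    rw [mem_regularSubdiff_iff hphi]
    intro ε hε
    filter_upwards [hf'.isLittleO.def hε] with z hz t ht
    rw [phi, coe_add_le_coe_iff, hepi] at ht
    have hneg : A (z - x, t - f z - G) ≤ 0 := by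
      rw [hA, LinearMap.sum_apply]
      refine Finset.sum_nonpos fun j hj => ?_
      have h1 : a j (z - x, t - f z - G) = a j (z, t - f z) - a j (x, G) := by
        rw [← map_sub]; rfl
      rw [LinearMap.smul_apply, smul_eq_mul, h1, (Finset.mem_filter.1 hj).2]
      exact mul_nonpos_of_nonneg_of_nonpos (hl j) (sub_nonpos.2 (ht j))
    rw [hAsplit] at hneg
    rw [Real.norm_eq_abs] at hz
    have := (abs_le.1 hz).1
    rw [hud]
    linarith
  · have hPe : P (EuclideanSpace.single i 1) = EuclideanSpace.single i 1 := by
      ext k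
      rw [hP]
      split_ifs with hk
      · have : k ≠ i := fun e => hi (e ▸ hk)
        simp [this]
      · rfl
    have h1 := hAQ (EuclideanSpace.single i 1) 0
    rw [hPe, hc₀] at h1
    have h2 := hud (EuclideanSpace.single i 1)
    rw [← h1] at h2
    have h3 : u i = w i := by
      simpa [EuclideanSpace.inner_single_right] using h2
    rw [h3]
    simp only [hw]
    field_simp

/-! ### Coordinate estimates -/

variable {n : ℕ}

theorem isClosed_box (x₀ : EuclideanSpace ℝ (Fin n)) (J : Set (Fin n)) (ρ : Fin n → ℝ) :
    IsClosed (box x₀ J ρ) := by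
  have : box x₀ J ρ = ⋂ i ∈ J, {x | |x i - x₀ i| ≤ ρ i} := by ext; simp [box]
  rw [this]
  exact isClosed_biInter fun i _ => isClosed_le (by fun_prop) continuous_const

/-- Near `y₀`, a nonnegative point `z` whose coordinates outside the support of `y₀` are dominated
by those of `y²` satisfies `|y i ^ 2 - z i| ≤ K |y i| √D` as soon as `dist (y²) z ≤ D ≤ 1`. -/
theorem exists_abs_sq_sub_le (y₀ : EuclideanSpace ℝ (Fin n)) :
    ∃ K : ℝ, 0 < K ∧ ∀ᶠ y in 𝓝 y₀, ∀ (z : EuclideanSpace ℝ (Fin n)) (D : ℝ), D ≤ 1 →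
      dist (sqVec y) z ≤ D → (∀ i, 0 ≤ z i) → (∀ i, y₀ i = 0 → z i ≤ y i ^ 2) →
      ∀ i, |y i ^ 2 - z i| ≤ K * |y i| * √D := by
  have hnn : ∀ i ∈ (Finset.univ : Finset (Fin n)), 0 ≤ 2 / |y₀ i| := fun i _ => by positivity
  have hsum := Finset.sum_nonneg hnn
  -- The sum dominates each `2 / |y₀ i|` on the support of `y₀`, where `|y i| > |y₀ i| / 2`; zero
  -- coordinates contribute `2 / 0 = 0`.
  refine ⟨1 + ∑ i, 2 / |y₀ i|, by linarith, ?_⟩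
  have hev : ∀ᶠ y : EuclideanSpace ℝ (Fin n) in 𝓝 y₀, ∀ i, y₀ i ≠ 0 → |y₀ i| / 2 < |y i| := by
    refine eventually_all.2 fun i => ?_
    by_cases hi : y₀ i = 0
    · simp [hi]
    have hc : Continuous fun y : EuclideanSpace ℝ (Fin n) => |y i| := by fun_prop
    exact ((hc.tendsto y₀).eventually (lt_mem_nhds (half_lt_self (abs_pos.2 hi)))).mono
      fun y hy _ => hy
  filter_upwards [hev] with y hy z D hD1 hD hz0 hz i
  have hD0 : 0 ≤ D := dist_nonneg.trans hD
  have hi : |y i ^ 2 - z i| ≤ D := by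
    refine le_trans ?_ hD
    rw [dist_eq_norm]
    exact PiLp.norm_apply_le (sqVec y - z) i
  have hs0 := Real.sqrt_nonneg D
  have hss := Real.mul_self_sqrt hD0
  rcases eq_or_ne (y₀ i) 0 with h0 | h0
  · have hle : |y i ^ 2 - z i| ≤ |y i| * √D := by
      refine abs_le_of_sq_le_sq ?_ (by positivity)
      rw [mul_pow, sq_abs, Real.sq_sqrt hD0, ← sq_abs, sq]
      have h1 : |y i ^ 2 - z i| ≤ y i ^ 2 := by
        rw [abs_of_nonneg (sub_nonneg.2 (hz i h0))]
        linarith [hz0 i]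
      exact mul_le_mul h1 hi (abs_nonneg _) (sq_nonneg _)
    have h2 : 0 ≤ |y i| * √D := by positivity
    nlinarith
  · have hK : 1 ≤ (1 + ∑ i, 2 / |y₀ i|) * |y i| := by
      have h1 := Finset.single_le_sum hnn (Finset.mem_univ i)
      have h2 := hy i h0
      have h3 : 0 < |y₀ i| := abs_pos.2 h0
      have h4 : 1 = 2 / |y₀ i| * (|y₀ i| / 2) := by field_simp
      rw [h4]
      exact mul_le_mul (by linarith) h2.le (by positivity) (by positivity)
    have hDs : D ≤ √D := Real.le_sqrt_of_sq_le (by nlinarith)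
    calc |y i ^ 2 - z i| ≤ 1 * √D := by linarith
      _ ≤ _ := by gcongr

/-- The factor `|y i|` in `hz` turns the uncontrolled `u i` into `v i / 2`. Where `y i = 0` it
forces `z i = 0`, so `u i` drops out. -/
theorem inner_sub_le_of_square {y u v z : EuclideanSpace ℝ (Fin n)} {K D : ℝ} (hK : 0 ≤ K)
    (hu : ∀ i, y i ≠ 0 → 2 * y i * u i = v i) (hz : ∀ i, |y i ^ 2 - z i| ≤ K * |y i| * √D) :
    inner ℝ u (sqVec y - z) ≤ n * K * √D * ‖v‖ := by
  have hterm : ∀ i ∈ (Finset.univ : Finset (Fin n)),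
      inner ℝ (u i) ((sqVec y - z) i) ≤ K * √D * ‖v‖ := fun i _ => by
    have h1 : inner ℝ (u i) ((sqVec y - z) i) = (y i ^ 2 - z i) * u i := by
      simp [sqVec]
    have h2 : |u i| * |y i| ≤ ‖v‖ := by
      rcases eq_or_ne (y i) 0 with h0 | h0
      · simp [h0]
      · have h3 : |v i| ≤ ‖v‖ := PiLp.norm_apply_le v i
        rw [← hu i h0, abs_mul, abs_mul, abs_two] at h3
        nlinarith [abs_nonneg (u i), abs_nonneg (y i), mul_nonneg (abs_nonneg (u i)) (abs_nonneg (y i))]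
    calc inner ℝ (u i) ((sqVec y - z) i) ≤ |y i ^ 2 - z i| * |u i| := by
          rw [h1, ← abs_mul]; exact le_abs_self _
      _ ≤ K * |y i| * √D * |u i| := by gcongr; exact hz i
      _ = K * √D * (|u i| * |y i|) := by ring
      _ ≤ _ := by gcongr
  rw [PiLp.inner_apply]
  refine (Finset.sum_le_sum hterm).trans (le_of_eq ?_)
  simp
  ring

end SquareKL

/-! ### The main theorem -/

theorem theorem6p2 {n : ℕ}
    (f : EuclideanSpace ℝ (Fin n) → ℝ) (g : EuclideanSpace ℝ (Fin n) → EReal)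
    (hf : ContDiff ℝ 2 f)
    (hg_proper : SquareKL.IsProper g) (hg_poly : SquareKL.IsPolyhedralFun g)
    (hg_dom : ∀ x ∈ SquareKL.dom g, ∀ i, 0 ≤ x i)
    (hconv : SquareKL.IsConvexFun (SquareKL.phi f g))
    (xbar ybar : EuclideanSpace ℝ (Fin n)) (hxy : xbar = SquareKL.sqVec ybar)
    (hstat : SquareKL.IsStationary (SquareKL.phi f g) xbar)
    (α γ : ℝ) (hα₀ : 0 < α) (hα₁ : α < 1) (hγ₀ : 0 < γ) (hγ₁ : γ ≤ 1)
    (herr : ∃ U ∈ 𝓝 xbar, ∃ c : ℝ, 0 < c ∧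
      ∀ ρ : Fin n → ℝ, (∀ i, 0 ≤ ρ i) →
        ∀ x ∈ U ∩ SquareKL.domSubdiff (SquareKL.phi f g),
          Metric.infDist x
              (SquareKL.argmin (SquareKL.phi f g) ∩ SquareKL.box xbar {i | xbar i ≠ 0}ᶜ ρ) ≤
            c * max (Metric.infDist x (SquareKL.argmin (SquareKL.phi f g)))
              (Metric.infDist x (SquareKL.box xbar {i | xbar i ≠ 0}ᶜ ρ)) ^ γ)
    (hKL : SquareKL.HasKLExponent (SquareKL.phi f g) xbar α) :
    SquareKL.HasKLExponent (SquareKL.bigPhi f g) ybar ((1 + (1 - γ * (1 - α))) / 2) := by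
  open SquareKL in
  obtain ⟨m, hm⟩ : ∃ m : ℝ, phi f g xbar = m :=
    ⟨_, (EReal.coe_toReal hstat.2.1 hstat.1).symm⟩
  have hmin : xbar ∈ argmin (phi f g) := hconv.mem_argmin_of_isStationary hstat
  have hcomp : bigPhi f g = phi f g ∘ sqVec := rfl
  have hPhi : bigPhi f g ybar = m := by rw [hcomp, Function.comp_apply, ← hxy, hm]
  have hPhimin : ybar ∈ argmin (bigPhi f g) := fun y => by
    rw [hPhi, ← hm]
    exact hmin (sqVec y)
  obtain ⟨C, hC, a, ha, V, hV, hVC⟩ := hKL.exists_infDist_argmin_le hmin hm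
  obtain ⟨U, hU, c, hc, hUc⟩ := herr
  obtain ⟨K, hK, hKev⟩ := exists_abs_sq_sub_le ybar
  have hlsc : LowerSemicontinuous (phi f g) := hKL.2.1
  have hγα : 0 < γ * (1 - α) := mul_pos hγ₀ (by linarith)
  have hγα1 : γ * (1 - α) < 1 := by nlinarith
  have hsq : Tendsto sqVec (𝓝 ybar) (𝓝 xbar) := hxy ▸ continuous_sqVec.tendsto ybar
  have hW := hKev.and ((hsq.eventually hV).and ((hsq.eventually hU).and
    (hsq.eventually (Metric.closedBall_mem_nhds xbar one_pos))))
  -- `n + 1` in place of `n` keeps `M` positive when `n = 0`.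
  set M : ℝ := (n + 1) * K * √(c * C ^ γ) with hM
  have hMpos : 0 < M := by
    have : 0 < C ^ γ := Real.rpow_pos_of_pos hC _
    positivity
  refine hasKLExponent_of_regular ⟨⟨ybar, ?_⟩, fun y => hKL.1.2 (sqVec y)⟩
    (hlsc.comp continuous_sqVec)
    ⟨0, regularSubdiff_subset_subdiff _ _ (zero_mem_regularSubdiff_of_mem_argmin hPhi hPhimin)⟩
    (by linarith) (by linarith) hPhi hMpos ha hW ?_
  · change bigPhi f g ybar < ⊤
    rw [hPhi]
    exact EReal.coe_lt_top m
  rintro y ⟨hyK, hyV, hyU, hyB⟩ r hr hmr hra v hv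
  obtain ⟨u, hu, huv⟩ := exists_mem_regularSubdiff_phi (hf.differentiable (by norm_num)) hg_poly hv
  have hrphi : phi f g (sqVec y) = r := hr
  set x := sqVec y with hx
  -- The smallest box containing `x`: the distance from `x` to it vanishes, and its points are
  -- dominated by `y²` off the support of `xbar`.
  set ρ : Fin n → ℝ := fun i => |x i - xbar i|
  set S := box xbar {i | xbar i ≠ 0}ᶜ ρ with hS
  have hxS : x ∈ S := fun i _ => le_rfl
  have hbS : xbar ∈ argmin (phi f g) ∩ S := ⟨hmin, fun i _ => by simp [ρ]⟩
  have hdS : Metric.infDist x S = 0 := Metric.infDist_zero_of_mem hxS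
  have hbound := hUc ρ (fun i => abs_nonneg _) x
    ⟨hyU, u, regularSubdiff_subset_subdiff _ _ hu⟩
  rw [← hS, hdS, max_eq_left Metric.infDist_nonneg] at hbound
  obtain ⟨z, ⟨hzmin, hzS⟩, hz⟩ := ((isClosed_argmin hlsc).inter
    (isClosed_box xbar _ ρ)).exists_infDist_eq_dist ⟨xbar, hbS⟩ x
  set D := dist x z with hD
  have hs : 0 < r - m := sub_pos.2 hmr
  have hDle : D ≤ c * C ^ γ * (r - m) ^ (γ * (1 - α)) := by
    rw [← hz]
    refine hbound.trans ?_
    rw [mul_assoc, mul_comm γ, Real.rpow_mul hs.le,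
      ← Real.mul_rpow hC.le (Real.rpow_nonneg hs.le _)]
    exact mul_le_mul_of_nonneg_left
      (Real.rpow_le_rpow Metric.infDist_nonneg (hVC x hyV r hrphi hra) hγ₀.le) hc.le
  have hD1 : D ≤ 1 := by
    rw [← hz]
    exact (Metric.infDist_le_dist_of_mem hbS).trans (Metric.mem_closedBall.1 hyB)
  have hzm : phi f g z ≤ m := hm ▸ hzmin xbar
  have hz0 : ∀ i, 0 ≤ z i :=
    hg_dom z ((coe_add_le_coe_iff.1 hzm).trans_lt (EReal.coe_lt_top _))
  have hzy : ∀ i, ybar i = 0 → z i ≤ y i ^ 2 := fun i hi => by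
    have hxi : xbar i = 0 := by rw [hxy]; simp [sqVec, hi]
    have h1 := hzS i (by simpa using hxi)
    simp only [ρ, hxi, sub_zero] at h1
    have h2 : x i = y i ^ 2 := rfl
    rw [h2, abs_of_nonneg (sq_nonneg (y i))] at h1
    exact (le_abs_self _).trans h1
  have hcoord := hyK z D hD1 le_rfl hz0 hzy
  have hinner := inner_sub_le_of_square hK.le huv hcoord
  have hsub := hconv.le_of_mem_regularSubdiff hrphi hu hzm
  rw [← neg_sub x z, inner_neg_right] at hsub
  have hsqrt : √D ≤ √(c * C ^ γ) * (r - m) ^ (γ * (1 - α) / 2) := by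
    refine (Real.sqrt_le_sqrt hDle).trans (le_of_eq ?_)
    rw [Real.sqrt_mul' _ (Real.rpow_nonneg hs.le _), Real.sqrt_eq_rpow ((r - m) ^ _),
      ← Real.rpow_mul hs.le]
    congr 2
    ring
  have hp : 0 < (r - m) ^ (γ * (1 - α) / 2) := Real.rpow_pos_of_pos hs _
  -- Multiplying by this power raises the exponent on the left to exactly `1`, where the convexity
  -- estimate applies.
  refine le_of_mul_le_mul_right ?_ hp
  rw [← Real.rpow_add hs]
  have hexp : (1 + (1 - γ * (1 - α))) / 2 + γ * (1 - α) / 2 = 1 := by ring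
  rw [hexp, Real.rpow_one]
  calc r - m ≤ inner ℝ u (x - z) := by linarith
    _ ≤ n * K * √D * ‖v‖ := hinner
    _ ≤ (n + 1) * K * (√(c * C ^ γ) * (r - m) ^ (γ * (1 - α) / 2)) * ‖v‖ := by
      gcongr
      linarith
    _ = _ := by rw [hM]; ring
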